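/- For integers $\ell,m\ge 1$ let the coefficients $p_n(\ell,m)$, $0\le n\le \ell m$, of the $q$-binomial (Gaussian) coefficient be defined by $$\binom{m+\ell}{m}_q=\frac{(q^{m+1}-1)\cdots(q^{m+\ell}-1)}{(q-1)\cdots(q^{\ell}-1)}=\sum_{n=0}^{\ell m}p_n(\ell,m)\,q^n .$$ Let $\ell,m\ge 2$ with $\ell\le m$. Then the strict unimodality $$(\circ)\qquad p_1(\ell,m)<\cdots<p_{\lfloor \ell m/2\rfloor}(\ell,m)=p_{\lceil \ell m/2\rceil}(\ell,m)>\cdots>p_{\ell m-1}(\ell,m)$$ holds if and only if either $\ell=m=2$, or $\ell,m\ge 5$ and $(\ell,m)$ is not one of the nine pairs $$(5,6),\ (5,10),\ (5,14),\ (6,6),\ (6,7),\ (6,9),\ (6,11),\ (6,13),\ (7,10).$$ -/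

import Mathlib

open Polynomial

/-- The numerator `(q^(m+1) - 1) ⋯ (q^(m+ℓ) - 1)` of the Gaussian coefficient. -/
noncomputable def qBinomNum (ℓ m : ℕ) : ℤ[X] :=
  ∏ i ∈ Finset.Icc 1 ℓ, (X ^ (m + i) - 1)

/-- The denominator `(q - 1) ⋯ (q^ℓ - 1)` of the Gaussian coefficient, a monic polynomial. -/
noncomputable def qBinomDen (ℓ : ℕ) : ℤ[X] :=
  ∏ i ∈ Finset.Icc 1 ℓ, (X ^ i - 1)

/-- The `q`-binomial (Gaussian) coefficient `binom(m+ℓ, m)_q`, as a polynomial in `q = X`.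
The division is by a monic polynomial and is exact, see `qBinomDen_mul_qBinom`. -/
noncomputable def qBinom (ℓ m : ℕ) : ℤ[X] :=
  qBinomNum ℓ m /ₘ qBinomDen ℓ

theorem qBinomDen_monic (ℓ : ℕ) : (qBinomDen ℓ).Monic := by
  unfold qBinomDen
  refine monic_prod_of_monic _ _ fun i hi => ?_
  have h : i ≠ 0 := by
    have := (Finset.mem_Icc.mp hi).1
    omega
  simpa using monic_X_pow_sub_C (1 : ℤ) h

theorem qBinomNum_succ (ℓ m : ℕ) :
    qBinomNum (ℓ + 1) m = qBinomNum ℓ m * (X ^ (m + (ℓ + 1)) - 1) := by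
  unfold qBinomNum
  rw [Finset.prod_Icc_succ_top (by omega)]

theorem qBinomDen_succ (ℓ : ℕ) :
    qBinomDen (ℓ + 1) = qBinomDen ℓ * (X ^ (ℓ + 1) - 1) := by
  unfold qBinomDen
  rw [Finset.prod_Icc_succ_top (by omega)]

theorem qBinomNum_succ' (ℓ m : ℕ) :
    qBinomNum (ℓ + 1) m = (X ^ (m + 1) - 1) * qBinomNum ℓ (m + 1) := by
  induction ℓ with
  | zero => simp [qBinomNum]
  | succ k ih =>
    rw [qBinomNum_succ (k + 1) m, ih, qBinomNum_succ k (m + 1), mul_assoc,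
      show m + (k + 1 + 1) = m + 1 + (k + 1) by ring]

theorem qBinomDen_dvd (ℓ m : ℕ) : qBinomDen ℓ ∣ qBinomNum ℓ m := by
  induction ℓ generalizing m with
  | zero => simp [qBinomDen, qBinomNum]
  | succ k ih =>
    induction m with
    | zero => simp [qBinomDen, qBinomNum]
    | succ m ihm =>
      have e : qBinomNum (k + 1) (m + 1) =
          qBinomNum k (m + 1) * (X ^ (k + 1) - 1) * X ^ (m + 1) + qBinomNum (k + 1) m := by
        rw [qBinomNum_succ k (m + 1), qBinomNum_succ' k m]
        ring
      rw [e]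
      refine dvd_add (Dvd.dvd.mul_right ?_ _) ihm
      rw [qBinomDen_succ]
      exact mul_dvd_mul_right (ih (m + 1)) _

/-- The quotient defining the Gaussian coefficient is exact. -/
theorem qBinomDen_mul_qBinom (ℓ m : ℕ) : qBinomDen ℓ * qBinom ℓ m = qBinomNum ℓ m := by
  have h := modByMonic_add_div (qBinomNum ℓ m) (qBinomDen ℓ)
  rwa [(modByMonic_eq_zero_iff_dvd (qBinomDen_monic ℓ)).mpr (qBinomDen_dvd ℓ m), zero_add] at h

/-- `qBinomCoeff ℓ m n` is `p_n(ℓ, m)`, the coefficient of `q^n` in `binom(m+ℓ, m)_q`. -/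
noncomputable def qBinomCoeff (ℓ m n : ℕ) : ℤ := (qBinom ℓ m).coeff n

/-- The strict inequalities
`p_1 < ⋯ < p_⌊ℓm/2⌋ = p_⌈ℓm/2⌉ > ⋯ > p_(ℓm-1)` for `p_n = p_n(ℓ, m)`. -/
def StrictlyUnimodal (ℓ m : ℕ) : Prop :=
  (∀ n, 1 ≤ n → n + 1 ≤ ℓ * m / 2 → qBinomCoeff ℓ m n < qBinomCoeff ℓ m (n + 1)) ∧
  qBinomCoeff ℓ m (ℓ * m / 2) = qBinomCoeff ℓ m ((ℓ * m + 1) / 2) ∧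
  (∀ n, (ℓ * m + 1) / 2 ≤ n → n + 1 ≤ ℓ * m - 1 →
    qBinomCoeff ℓ m n > qBinomCoeff ℓ m (n + 1))

/-! The number `p_k(ℓ, m)` counts monomials of degree `ℓ` and weight `k` in `a_0, …, a_m`, so it is
the dimension of a weight space of the `sl₂`-module `Sym^ℓ(Sym^m)`. Strictly below the middle
weight, the raising operator out of the next weight space is onto (`raisingOn_surjective`). Hence
`p_k - p_(k-1)` is the dimension of its kernel, the space of seminvariants of degree `ℓ` and weight
`k`, and a strict step means that a nonzero seminvariant exists (`qBinomCoeff_lt_succ_iff`).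

Seminvariants form a subring of an integral domain, so nonzero ones of degrees `l` and `l'` multiply
to a nonzero one of degree `l + l'`. Strict increase is therefore additive in `ℓ` for fixed `m`
(`StrictlyIncreasing.add`). Adding `8` repeatedly, in either argument, reduces the positive cases to
finitely many pairs. These are checked by reading the coefficients as base `2 ^ 32` digits of the
value at `q = 2 ^ 32`.

Conversely, for `ℓ = 2, 3, 4` the generating function of the differences exhibits a step near the
middle (for `ℓ = 2`, the step from `p_2` to `p_3`) that is not strict. The nine sporadic pairs are
refuted by the digit computation. -/

/-! ### The `sl₂`-action on polynomials in `a_0, …, a_m`. -/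

/-- The bigrading of `ℚ[a_0, …, a_m]` by degree and weight: `a_i` has degree `1` and weight `i`. -/
def biweight (m : ℕ) (i : Fin (m + 1)) : ℤ × ℤ := (1, (i : ℕ))

/-- The component of degree `l` and weight `k` of `ℚ[a_0, …, a_m]`. -/
noncomputable def bigraded (m : ℕ) (l k : ℤ) : Submodule ℚ (MvPolynomial (Fin (m + 1)) ℚ) :=
  MvPolynomial.weightedHomogeneousSubmodule ℚ (biweight m) (l, k)

theorem derivation_mem_weightedHomogeneous {σ M : Type*} [AddCommGroup M] (w : σ → M) (δ : M)
    (D : Derivation ℚ (MvPolynomial σ ℚ) (MvPolynomial σ ℚ))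
    (hD : ∀ i, (D (MvPolynomial.X i)).IsWeightedHomogeneous w (w i + δ))
    {d : M} {p : MvPolynomial σ ℚ} (hp : p.IsWeightedHomogeneous w d) :
    (D p).IsWeightedHomogeneous w (d + δ) := by
  have hDm : D = MvPolynomial.mkDerivation ℚ fun i => D (MvPolynomial.X i) :=
    MvPolynomial.derivation_ext fun i => by simp
  rw [p.as_sum, map_sum]
  refine MvPolynomial.IsWeightedHomogeneous.sum _ _ _ fun s hs => ?_
  have hw := hp (MvPolynomial.mem_support_iff.mp hs)
  rw [hDm, MvPolynomial.mkDerivation_monomial]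
  rw [MvPolynomial.smul_eq_C_mul]
  refine MvPolynomial.IsWeightedHomogeneous.C_mul ?_ _
  refine MvPolynomial.IsWeightedHomogeneous.sum _ _ _ fun i hi => ?_
  have hi' : Finsupp.single i 1 ≤ s := by
    simpa [Nat.one_le_iff_ne_zero] using hi
  have e : d + δ = Finsupp.weight w (s - Finsupp.single i 1) + (w i + δ) := by
    rw [← hw]
    conv_lhs => rw [← tsub_add_cancel_of_le hi']
    rw [map_add, Finsupp.weight_single, one_smul, add_assoc]
  rw [e]
  exact (MvPolynomial.isWeightedHomogeneous_monomial w _ _ rfl).mul (hD i)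

/-- The raising operator `a_i ↦ i a_{i-1}`. -/
noncomputable def raising (m : ℕ) :
    Derivation ℚ (MvPolynomial (Fin (m + 1)) ℚ) (MvPolynomial (Fin (m + 1)) ℚ) :=
  MvPolynomial.mkDerivation ℚ fun i =>
    MvPolynomial.C ((i : ℕ) : ℚ) * MvPolynomial.X ⟨(i : ℕ) - 1, by omega⟩

/-- The lowering operator `a_i ↦ (m - i) a_{i+1}`. -/
noncomputable def lowering (m : ℕ) :
    Derivation ℚ (MvPolynomial (Fin (m + 1)) ℚ) (MvPolynomial (Fin (m + 1)) ℚ) :=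
  MvPolynomial.mkDerivation ℚ fun i =>
    MvPolynomial.C ((m : ℚ) - (i : ℕ)) * MvPolynomial.X ⟨min ((i : ℕ) + 1) m, by omega⟩

theorem raising_mem {m : ℕ} {l k : ℤ} {p : MvPolynomial (Fin (m + 1)) ℚ}
    (hp : p ∈ bigraded m l k) : raising m p ∈ bigraded m l (k - 1) := by
  have := derivation_mem_weightedHomogeneous (biweight m) (0, -1) (raising m) (fun i => ?_) hp
  · simpa [bigraded, sub_eq_add_neg] using this
  · rw [raising, MvPolynomial.mkDerivation_X]
    by_cases hi : (i : ℕ) = 0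
    · simpa [hi] using MvPolynomial.isWeightedHomogeneous_zero _ _ _
    · refine MvPolynomial.IsWeightedHomogeneous.C_mul ?_ _
      have e : biweight m i + (0, -1) = biweight m ⟨(i : ℕ) - 1, by omega⟩ := by
        refine Prod.ext (by simp [biweight]) ?_
        show ((i : ℕ) : ℤ) + -1 = ((i : ℕ) - 1 : ℕ)
        omega
      rw [e]
      exact MvPolynomial.isWeightedHomogeneous_X ℚ (biweight m) _

theorem lowering_mem {m : ℕ} {l k : ℤ} {p : MvPolynomial (Fin (m + 1)) ℚ}
    (hp : p ∈ bigraded m l k) : lowering m p ∈ bigraded m l (k + 1) := by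
  have := derivation_mem_weightedHomogeneous (biweight m) (0, 1) (lowering m) (fun i => ?_) hp
  · simpa [bigraded] using this
  · rw [lowering, MvPolynomial.mkDerivation_X]
    by_cases hi : (i : ℕ) = m
    · simpa [hi] using MvPolynomial.isWeightedHomogeneous_zero _ _ _
    · refine MvPolynomial.IsWeightedHomogeneous.C_mul ?_ _
      have e : biweight m i + (0, 1) = biweight m ⟨min ((i : ℕ) + 1) m, by omega⟩ := by
        refine Prod.ext (by simp [biweight]) ?_
        show ((i : ℕ) : ℤ) + 1 = (min ((i : ℕ) + 1) m : ℕ)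
        omega
      rw [e]
      exact MvPolynomial.isWeightedHomogeneous_X ℚ (biweight m) _

theorem derivation_diagonal_apply {σ : Type*} (c : σ → ℚ) {s : σ →₀ ℕ} (a : ℚ) :
    MvPolynomial.mkDerivation ℚ (fun i => MvPolynomial.C (c i) * MvPolynomial.X i)
      (MvPolynomial.monomial s a) =
    MvPolynomial.C (s.sum fun i n => n * c i) * MvPolynomial.monomial s a := by
  rw [MvPolynomial.mkDerivation_monomial, MvPolynomial.smul_eq_C_mul, Finsupp.sum, Finsupp.sum,
    map_sum, Finset.mul_sum, Finset.sum_mul]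
  refine Finset.sum_congr rfl fun i hi => ?_
  have hi' : Finsupp.single i 1 ≤ s := by
    simpa [Nat.one_le_iff_ne_zero] using hi
  have : (MvPolynomial.X i : MvPolynomial σ ℚ) = MvPolynomial.monomial (Finsupp.single i 1) 1 := rfl
  rw [this, smul_eq_mul, MvPolynomial.C_mul_monomial, MvPolynomial.monomial_mul,
    tsub_add_cancel_of_le hi', MvPolynomial.C_mul_monomial, MvPolynomial.C_mul_monomial]
  congr 1
  ring

theorem weight_biweight {m : ℕ} (s : Fin (m + 1) →₀ ℕ) :
    Finsupp.weight (biweight m) s = (∑ i, (s i : ℤ), ∑ i, (s i : ℤ) * (i : ℕ)) := by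
  rw [Finsupp.weight_apply, Finsupp.sum_fintype _ _ (by simp)]
  ext
  · simp [biweight, Prod.fst_sum]
  · simp [biweight, Prod.snd_sum]

theorem derivation_C_mul_eq {σ : Type*} (D : Derivation ℚ (MvPolynomial σ ℚ) (MvPolynomial σ ℚ))
    (a : ℚ) (p : MvPolynomial σ ℚ) : D (MvPolynomial.C a * p) = MvPolynomial.C a * D p := by
  rw [← MvPolynomial.smul_eq_C_mul, Derivation.map_smul, MvPolynomial.smul_eq_C_mul]

theorem raising_lowering {m : ℕ} {l k : ℤ} {p : MvPolynomial (Fin (m + 1)) ℚ}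
    (hp : p ∈ bigraded m l k) :
    raising m (lowering m p) = lowering m (raising m p) +
      MvPolynomial.C ((l : ℚ) * m - 2 * k) * p := by
  -- A commutator of derivations is a derivation, so it is determined on the variables; there it is
  -- diagonal, and monomials are eigenvectors.
  have h : ⁅raising m, lowering m⁆ = MvPolynomial.mkDerivation ℚ
      (fun i : Fin (m + 1) => MvPolynomial.C ((m : ℚ) - 2 * (i : ℕ)) * MvPolynomial.X i) := by
    refine MvPolynomial.derivation_ext fun i => ?_
    rw [Derivation.commutator_apply]
    simp only [raising, lowering, MvPolynomial.mkDerivation_X, derivation_C_mul_eq]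
    -- At the ends `i = m` (here) and `i = 0` (in `e2`) the truncated index is wrong, but the
    -- coefficient vanishes.
    have e1 : MvPolynomial.C ((m : ℚ) - (i : ℕ)) * (MvPolynomial.C ((min ((i : ℕ) + 1) m : ℕ) : ℚ) *
        MvPolynomial.X (R := ℚ) (⟨min ((i : ℕ) + 1) m - 1, by omega⟩ : Fin (m + 1))) =
        MvPolynomial.C (((m : ℚ) - (i : ℕ)) * ((i : ℕ) + 1)) * MvPolynomial.X i := by
      rcases eq_or_ne (i : ℕ) m with hi | hi
      · simp [hi]
      · rw [← mul_assoc, ← map_mul]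
        have : min ((i : ℕ) + 1) m = i + 1 := by omega
        congr 2
        · rw [this]; push_cast; ring
        · ext; simp [this]
    have e2 : MvPolynomial.C (((i : ℕ) : ℚ)) * (MvPolynomial.C ((m : ℚ) - ((i - 1 : ℕ) : ℕ)) *
        MvPolynomial.X (R := ℚ) (⟨min ((i - 1 : ℕ) + 1) m, by omega⟩ : Fin (m + 1))) =
        MvPolynomial.C (((i : ℕ) : ℚ) * ((m : ℚ) - (i : ℕ) + 1)) * MvPolynomial.X i := by
      rcases eq_or_ne (i : ℕ) 0 with hi | hi
      · simp [hi]
      · rw [← mul_assoc, ← map_mul]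
        have : min ((i : ℕ) - 1 + 1) m = i := by omega
        congr 2
        · rw [Nat.cast_sub (by omega)]; push_cast; ring
        · ext; simp [this]
    rw [e1, e2, ← sub_mul, ← map_sub]
    congr 2
    ring
  have h2 : ⁅raising m, lowering m⁆ p = MvPolynomial.C ((l : ℚ) * m - 2 * k) * p := by
    rw [h, p.as_sum, map_sum, Finset.mul_sum]
    refine Finset.sum_congr rfl fun s hs => ?_
    rw [derivation_diagonal_apply]
    congr 2
    have hw := hp (MvPolynomial.mem_support_iff.mp hs)
    rw [weight_biweight, Prod.mk.injEq] at hw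
    rw [Finsupp.sum_fintype _ _ (by simp), ← hw.1, ← hw.2]
    push_cast
    rw [Finset.sum_mul, Finset.mul_sum, ← Finset.sum_sub_distrib]
    exact Finset.sum_congr rfl fun i _ => by ring
  rw [← h2, Derivation.commutator_apply]
  ring

/-! ### Weight spaces and surjectivity of the raising operator. -/

theorem biweight_fiber_finite (m : ℕ) (l k : ℤ) :
    {s : Fin (m + 1) →₀ ℕ | Finsupp.weight (biweight m) s = (l, k)}.Finite := by
  refine (Set.finite_Iic (Finsupp.equivFunOnFinite.symm fun _ => l.toNat)).subset fun s hs => ?_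
  rw [Set.mem_ofPred_eq, weight_biweight, Prod.mk.injEq] at hs
  intro i
  have : (s i : ℤ) ≤ ∑ i, (s i : ℤ) :=
    Finset.single_le_sum (f := fun i => (s i : ℤ)) (fun _ _ => by positivity) (Finset.mem_univ i)
  simp only [Finsupp.equivFunOnFinite_symm_apply_apply]
  omega

theorem bigraded_finite_finrank (m : ℕ) (l k : ℤ) :
    Module.Finite ℚ (bigraded m l k) ∧ Module.finrank ℚ (bigraded m l k) =
      {s : Fin (m + 1) →₀ ℕ | Finsupp.weight (biweight m) s = (l, k)}.ncard := by
  have := (biweight_fiber_finite m l k).fintype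
  rw [bigraded, MvPolynomial.weightedHomogeneousSubmodule_eq_finsupp_supported]
  let b := MvPolynomial.basisRestrictSupport ℚ
    {s : Fin (m + 1) →₀ ℕ | Finsupp.weight (biweight m) s = (l, k)}
  refine ⟨Module.Finite.of_basis b, ?_⟩
  exact Module.finrank_eq_nat_card_basis b

instance (m : ℕ) (l k : ℤ) : Module.Finite ℚ (bigraded m l k) := (bigraded_finite_finrank m l k).1

theorem bigraded_eq_zero_of_neg {m : ℕ} {l k : ℤ} (hk : k < 0)
    {p : MvPolynomial (Fin (m + 1)) ℚ} (hp : p ∈ bigraded m l k) : p = 0 := by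
  ext s
  by_contra hs
  have hw := hp hs
  rw [weight_biweight, Prod.mk.injEq] at hw
  have : 0 ≤ ∑ i, (s i : ℤ) * (i : ℕ) := Finset.sum_nonneg fun i _ => by positivity
  omega

/-- With `R`, `L` the two operators, `RLp + cp = 0` becomes `LRp + c'p = 0` with `c' = c + lm - 2k >
0`. Applying `R` gives the same kind of equation for `Rp`, one weight lower, so `Rp = 0` by
induction and then `c'p = 0`. The constant `c` is there for this induction; only `c = 0` is used
later. -/
theorem eq_zero_of_raising_lowering {m : ℕ} {l : ℤ} (n : ℕ) :
    ∀ {k : ℤ}, k < n → 2 * k < l * m → ∀ c : ℚ, 0 ≤ c →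
    ∀ p ∈ bigraded m l k, raising m (lowering m p) + MvPolynomial.C c * p = 0 → p = 0 := by
  induction n with
  | zero => exact fun hk _ _ _ p hp _ => bigraded_eq_zero_of_neg (by simpa using hk) hp
  | succ n ih =>
    intro k hk hl c hc p hp h
    have hpos : (0 : ℚ) < l * m - 2 * k := by
      have : ((2 * k : ℤ) : ℚ) < ((l * m : ℤ) : ℚ) := by exact_mod_cast hl
      push_cast at this
      linarith
    rw [raising_lowering hp, add_assoc, ← add_mul, ← map_add] at h
    have h1 := congrArg (raising m) h
    rw [map_add, map_zero, derivation_C_mul_eq] at h1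
    have h2 := ih (k := k - 1) (by push_cast at hk; omega) (by omega) _ (by positivity) _
      (raising_mem hp) h1
    rw [h2, map_zero, zero_add, mul_eq_zero, MvPolynomial.C_eq_zero] at h
    exact h.resolve_left (by positivity)

/-- The raising operator between bigraded components. -/
noncomputable def raisingOn (m : ℕ) (l k : ℤ) : bigraded m l k →ₗ[ℚ] bigraded m l (k - 1) :=
  (raising m).toLinearMap.restrict fun _ hp => raising_mem hp

/-- Raising after lowering is an injective endomorphism of a finite-dimensional space, hence onto.
-/
theorem raisingOn_surjective {m : ℕ} {l k : ℤ} (hk : 2 * (k - 1) < l * m) :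
    Function.Surjective (raisingOn m l k) := by
  let f : bigraded m l (k - 1) →ₗ[ℚ] bigraded m l (k - 1) :=
    ((raising m).toLinearMap ∘ₗ (lowering m).toLinearMap).restrict fun p hp => by
      simpa using raising_mem (lowering_mem hp)
  have hf : Function.Injective f := by
    rw [← LinearMap.ker_eq_bot, LinearMap.ker_eq_bot']
    rintro ⟨p, hp⟩ h
    have h' : raising m (lowering m p) = 0 := congrArg Subtype.val h
    exact Subtype.ext (eq_zero_of_raising_lowering (k - 1).toNat.succ (by omega) hk 0 le_rfl p hp
      (by simp [h']))
  intro q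
  obtain ⟨p, hp⟩ := (LinearMap.injective_iff_surjective.mp hf) q
  refine ⟨⟨lowering m p, by simpa using lowering_mem p.2⟩, ?_⟩
  rw [← hp]
  rfl

/-! ### Seminvariants and dimension jumps. -/

/-- Existence of a nonzero seminvariant of degree `l` and weight `k` of the binary form of
degree `m`. -/
def HasSeminvariant (m : ℕ) (l k : ℤ) : Prop :=
  ∃ p ∈ bigraded m l k, p ≠ 0 ∧ raising m p = 0

theorem HasSeminvariant.mul {m : ℕ} {l l' k k' : ℤ} (h : HasSeminvariant m l k)
    (h' : HasSeminvariant m l' k') : HasSeminvariant m (l + l') (k + k') := by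
  obtain ⟨p, hp, hp0, hpr⟩ := h
  obtain ⟨q, hq, hq0, hqr⟩ := h'
  exact ⟨p * q, MvPolynomial.IsWeightedHomogeneous.mul hp hq, mul_ne_zero hp0 hq0,
    by rw [Derivation.leibniz, hpr, hqr, smul_zero, smul_zero, add_zero]⟩

theorem hasSeminvariant_zero (m l : ℕ) : HasSeminvariant m l 0 := by
  refine ⟨MvPolynomial.X 0 ^ l, ?_, pow_ne_zero _ (MvPolynomial.X_ne_zero _), ?_⟩
  · have := (MvPolynomial.isWeightedHomogeneous_X ℚ (biweight m) 0).pow l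
    simpa [bigraded, biweight] using this
  · simp [Derivation.leibniz_pow, raising]

theorem hasSeminvariant_of_finrank_lt {m : ℕ} {l k : ℤ}
    (h : Module.finrank ℚ (bigraded m l (k - 1)) < Module.finrank ℚ (bigraded m l k)) :
    HasSeminvariant m l k := by
  obtain ⟨p, hp, hp0⟩ := Submodule.exists_mem_ne_zero_of_ne_bot
    ((raisingOn m l k).ker_ne_bot_of_finrank_lt h)
  exact ⟨p, p.2, by simpa using hp0, congrArg Subtype.val (LinearMap.mem_ker.mp hp)⟩

theorem HasSeminvariant.finrank_lt {m : ℕ} {l k : ℤ} (h : HasSeminvariant m l k)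
    (hk : 2 * (k - 1) < l * m) :
    Module.finrank ℚ (bigraded m l (k - 1)) < Module.finrank ℚ (bigraded m l k) := by
  obtain ⟨p, hp, hp0, hpr⟩ := h
  have h1 := (raisingOn m l k).finrank_range_add_finrank_ker
  rw [LinearMap.range_eq_top.mpr (raisingOn_surjective hk), finrank_top] at h1
  have h2 : 0 < Module.finrank ℚ (LinearMap.ker (raisingOn m l k)) := by
    refine Nat.pos_of_ne_zero fun h0 => ?_
    revert h0
    rw [Submodule.finrank_eq_zero, imp_false]
    refine (Submodule.ne_bot_iff _).mpr ⟨⟨p, hp⟩, LinearMap.mem_ker.mpr (Subtype.ext hpr), ?_⟩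
    simpa using hp0
  omega

/-! ### Symmetry, Pascal rules, degree and palindromicity of Gaussian coefficients. -/

/-- `qBinomDen` plays the role of the factorial; this gives the form of the quotient that is
symmetric in `l` and `m`. -/
theorem qBinomNum_one_mul (l m : ℕ) : qBinomDen m * qBinomNum l m = qBinomDen (m + l) := by
  induction l with
  | zero => simp [qBinomNum]
  | succ l ih => rw [qBinomNum_succ, ← mul_assoc, ih, ← add_assoc, qBinomDen_succ]

theorem qBinomDen_ne_zero (l : ℕ) : qBinomDen l ≠ 0 := (qBinomDen_monic l).ne_zero

theorem qBinom_comm (l m : ℕ) : qBinom l m = qBinom m l := by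
  apply mul_left_cancel₀ (mul_ne_zero (qBinomDen_ne_zero m) (qBinomDen_ne_zero l))
  rw [mul_assoc, qBinomDen_mul_qBinom, qBinomNum_one_mul, mul_comm (qBinomDen m), mul_assoc,
    qBinomDen_mul_qBinom, qBinomNum_one_mul, add_comm]

theorem qBinom_zero_left (m : ℕ) : qBinom 0 m = 1 := by
  simpa [qBinomDen, qBinomNum] using qBinomDen_mul_qBinom 0 m

theorem qBinom_zero_right (l : ℕ) : qBinom l 0 = 1 := by
  rw [qBinom_comm, qBinom_zero_left]

theorem qBinom_succ_succ (l m : ℕ) :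
    qBinom (l + 1) (m + 1) = qBinom l (m + 1) * X ^ (m + 1) + qBinom (l + 1) m := by
  apply mul_left_cancel₀ (qBinomDen_ne_zero (l + 1))
  rw [qBinomDen_mul_qBinom, mul_add, qBinomDen_mul_qBinom, qBinomDen_succ,
    show qBinomDen l * (X ^ (l + 1) - 1) * (qBinom l (m + 1) * X ^ (m + 1)) =
      (qBinomDen l * qBinom l (m + 1)) * (X ^ (l + 1) - 1) * X ^ (m + 1) by ring,
    qBinomDen_mul_qBinom, qBinomNum_succ l (m + 1), qBinomNum_succ' l m]
  ring

theorem qBinom_succ_succ' (l m : ℕ) :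
    qBinom (l + 1) (m + 1) = qBinom (l + 1) m * X ^ (l + 1) + qBinom l (m + 1) := by
  rw [qBinom_comm, qBinom_succ_succ, qBinom_comm m, qBinom_comm (m + 1)]

theorem qBinom_monic (l m : ℕ) : (qBinom l m).Monic := by
  refine (qBinomDen_monic l).of_mul_monic_left ?_
  rw [qBinomDen_mul_qBinom]
  refine (qBinomDen_monic m).of_mul_monic_left ?_
  rw [qBinomNum_one_mul]
  exact qBinomDen_monic _

theorem natDegree_X_pow_sub_one (n : ℕ) : (X ^ n - 1 : ℤ[X]).natDegree = n := by
  simpa using natDegree_X_pow_sub_C (n := n) (r := (1 : ℤ))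

theorem natDegree_qBinom (l m : ℕ) : (qBinom l m).natDegree = l * m := by
  have h1 : ∀ i ∈ Finset.Icc 1 l, (X ^ (m + i) - 1 : ℤ[X]) ≠ 0 := fun i hi => by
    have := (Finset.mem_Icc.mp hi).1
    simpa using X_pow_sub_C_ne_zero (R := ℤ) (show 0 < m + i by omega) 1
  have h2 : ∀ i ∈ Finset.Icc 1 l, (X ^ i - 1 : ℤ[X]) ≠ 0 := fun i hi => by
    simpa using X_pow_sub_C_ne_zero (R := ℤ) (show 0 < i from (Finset.mem_Icc.mp hi).1) 1
  have h := congrArg natDegree (qBinomDen_mul_qBinom l m)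
  rw [natDegree_mul (qBinomDen_ne_zero l) (qBinom_monic l m).ne_zero, qBinomDen, qBinomNum,
    natDegree_prod _ _ h1, natDegree_prod _ _ h2] at h
  have h3 : ∑ i ∈ Finset.Icc 1 l, (X ^ (m + i) - 1 : ℤ[X]).natDegree =
      l * m + ∑ i ∈ Finset.Icc 1 l, i := by
    simp_rw [natDegree_X_pow_sub_one]
    rw [Finset.sum_add_distrib]
    simp
  simp_rw [h3, natDegree_X_pow_sub_one] at h
  omega

theorem reverse_X_pow_sub_one (n : ℕ) :
    (X ^ n - 1 : ℤ[X]).reverse = -(X ^ n - 1) := by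
  ext k
  rw [coeff_reverse, natDegree_X_pow_sub_one]
  rcases le_or_gt k n with h | h
  · rw [revAt_le h]
    simp only [coeff_sub, coeff_X_pow, coeff_one, coeff_neg]
    split_ifs <;> first | rfl | omega
  · rw [revAt_eq_self_of_lt h]
    simp only [coeff_sub, coeff_X_pow, coeff_one, coeff_neg]
    split_ifs <;> first | rfl | omega

theorem reverse_qBinomNum (l m : ℕ) : (qBinomNum l m).reverse = (-1) ^ l * qBinomNum l m := by
  induction l with
  | zero => simpa [qBinomNum] using reverse_C (1 : ℤ)
  | succ l ih =>
    rw [qBinomNum_succ, reverse_mul_of_domain, ih, reverse_X_pow_sub_one]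
    ring

theorem qBinomDen_eq (l : ℕ) : qBinomDen l = qBinomNum l 0 := by
  simp [qBinomDen, qBinomNum]

/-- Reversal multiplies numerator and denominator by the same sign `(-1) ^ l`. -/
theorem reverse_qBinom (l m : ℕ) : (qBinom l m).reverse = qBinom l m := by
  have h := congrArg reverse (qBinomDen_mul_qBinom l m)
  rw [reverse_mul_of_domain, reverse_qBinomNum, qBinomDen_eq, reverse_qBinomNum, mul_assoc] at h
  have h' := mul_left_cancel₀ (pow_ne_zero l (by simp)) h
  rw [← qBinomDen_eq, ← qBinomDen_mul_qBinom] at h'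
  exact mul_left_cancel₀ (qBinomDen_ne_zero l) h'

theorem qBinomCoeff_sub {l m n : ℕ} (h : n ≤ l * m) :
    qBinomCoeff l m (l * m - n) = qBinomCoeff l m n := by
  conv_rhs => rw [qBinomCoeff, ← reverse_qBinom, coeff_reverse, natDegree_qBinom, revAt_le h]
  rfl

theorem qBinomCoeff_comm (l m n : ℕ) : qBinomCoeff l m n = qBinomCoeff m l n := by
  rw [qBinomCoeff, qBinom_comm, qBinomCoeff]

/-- The coefficients of the Gaussian coefficient increase strictly from index `1` to the middle. -/
def StrictlyIncreasing (l m : ℕ) : Prop :=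
  ∀ k, 1 ≤ k → 2 * (k + 1) ≤ l * m → qBinomCoeff l m k < qBinomCoeff l m (k + 1)

theorem StrictlyIncreasing.comm {l m : ℕ} (h : StrictlyIncreasing l m) :
    StrictlyIncreasing m l := fun k h1 h2 => by
  rw [qBinomCoeff_comm m, qBinomCoeff_comm m]
  exact h k h1 (by rwa [mul_comm l])

theorem strictlyUnimodal_iff (l m : ℕ) : StrictlyUnimodal l m ↔ StrictlyIncreasing l m := by
  constructor
  · exact fun h k h1 h2 => h.1 k h1 (by omega)
  · intro h
    refine ⟨fun k h1 h2 => h k h1 (by omega), ?_, fun n h1 h2 => ?_⟩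
    · rw [← qBinomCoeff_sub (Nat.div_le_self _ 2)]
      congr 1
      omega
    · have := h (l * m - (n + 1)) (by omega) (by omega)
      rwa [qBinomCoeff_sub (by omega), show l * m - (n + 1) + 1 = l * m - n by omega,
        qBinomCoeff_sub (by omega)] at this

/-! ### Coefficients as dimensions of weight spaces. -/

/-- The number of monomials of degree `l` and weight `k` in `a_0, …, a_m`. -/
noncomputable def monomialCount (m : ℕ) (l k : ℤ) : ℕ :=
  {s : Fin (m + 1) →₀ ℕ | Finsupp.weight (biweight m) s = (l, k)}.ncard

theorem mem_biweight_fiber {m : ℕ} {l k : ℤ} {s : Fin (m + 1) →₀ ℕ} :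
    Finsupp.weight (biweight m) s = (l, k) ↔
      ∑ i, (s i : ℤ) = l ∧ ∑ i, (s i : ℤ) * (i : ℕ) = k := by
  rw [weight_biweight, Prod.mk.injEq]

theorem monomialCount_eq_zero {m : ℕ} {l k : ℤ} (hk : l < 0 ∨ k < 0) : monomialCount m l k = 0 := by
  rw [monomialCount, Set.ncard_eq_zero (biweight_fiber_finite m l k), Set.eq_empty_iff_forall_notMem]
  intro s hs
  obtain ⟨h1, h2⟩ := mem_biweight_fiber.mp hs
  have h3 : 0 ≤ ∑ i, (s i : ℤ) := Finset.sum_nonneg fun i _ => by positivity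
  have h4 : 0 ≤ ∑ i, (s i : ℤ) * (i : ℕ) := Finset.sum_nonneg fun i _ => by positivity
  omega

theorem monomialCount_zero_left (l k : ℕ) : monomialCount 0 l k = if k = 0 then 1 else 0 := by
  split_ifs with h
  · rw [monomialCount, Set.ncard_eq_one]
    refine ⟨Finsupp.single 0 l, Set.ext fun s => ?_⟩
    refine mem_biweight_fiber.trans ?_
    simp only [Nat.reduceAdd, Finset.univ_unique, Fin.default_eq_zero, Finset.sum_singleton,
      Set.mem_singleton_iff]
    constructor
    · rintro ⟨h1, -⟩
      ext i
      obtain rfl : i = 0 := Fin.fin_one_eq_zero i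
      simpa using h1
    · rintro rfl
      simp [h]
  · rw [monomialCount, Set.ncard_eq_zero (biweight_fiber_finite _ _ _),
      Set.eq_empty_iff_forall_notMem]
    intro s hs
    have := (mem_biweight_fiber.mp hs).2
    simp at this
    omega

theorem monomialCount_zero_right (m k : ℕ) : monomialCount m 0 k = if k = 0 then 1 else 0 := by
  have key : ∀ s : Fin (m + 1) →₀ ℕ, ∑ i, (s i : ℤ) = 0 → s = 0 := fun s hs => by
    rw [Finset.sum_eq_zero_iff_of_nonneg fun i _ => by positivity] at hs
    ext i
    simpa using hs i (Finset.mem_univ i)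
  split_ifs with h
  · rw [monomialCount, Set.ncard_eq_one]
    refine ⟨0, Set.ext fun s => mem_biweight_fiber.trans ⟨fun h => key s h.1, ?_⟩⟩
    rintro rfl
    simp [h]
  · rw [monomialCount, Set.ncard_eq_zero (biweight_fiber_finite _ _ _),
      Set.eq_empty_iff_forall_notMem]
    intro s hs
    obtain ⟨h1, h2⟩ := mem_biweight_fiber.mp hs
    rw [key s h1] at h2
    simp at h2
    omega

theorem sum_mul_val_succ {m : ℕ} (s : Fin (m + 1 + 1) → ℕ) :
    ∑ i, (s i : ℤ) * (i : ℕ) =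
      ∑ i : Fin (m + 1), (s i.succ : ℤ) * (i : ℕ) + ∑ i : Fin (m + 1), (s i.succ : ℤ) := by
  rw [Fin.sum_univ_succ, ← Finset.sum_add_distrib]
  simp only [Fin.val_zero, Nat.cast_zero, mul_zero, zero_add, Fin.val_succ, Nat.cast_add,
    Nat.cast_one, mul_add, mul_one]

/-- Pascal's rule: either `a_0` divides the monomial and can be removed, or all `l` indices can be
lowered by one, which costs weight `l`. -/
theorem monomialCount_succ (m : ℕ) (l k : ℤ) :
    monomialCount (m + 1) l k = monomialCount (m + 1) (l - 1) k + monomialCount m l (k - l) := by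
  have h1 : ((fun s => s + Finsupp.single 0 1) '' {s : Fin (m + 1 + 1) →₀ ℕ |
      Finsupp.weight (biweight (m + 1)) s = (l - 1, k)}) ∪
      ((Finsupp.cons 0) '' {s : Fin (m + 1) →₀ ℕ |
      Finsupp.weight (biweight m) s = (l, k - l)}) =
      {s : Fin (m + 1 + 1) →₀ ℕ | Finsupp.weight (biweight (m + 1)) s = (l, k)} := by
    ext s
    simp only [Set.mem_union, Set.mem_image, Set.mem_ofPred_eq]
    constructor
    · rintro (⟨t, ht, rfl⟩ | ⟨t, ht, rfl⟩)
      · rw [map_add, ht, Finsupp.weight_single]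
        simp [biweight]
      · rw [mem_biweight_fiber] at ht ⊢
        rw [sum_mul_val_succ, Fin.sum_univ_succ]
        simp only [Finsupp.cons_zero, Finsupp.cons_succ]
        omega
    · intro hs
      by_cases h0 : s 0 = 0
      · refine Or.inr ⟨s.tail, ?_, ?_⟩
        · rw [mem_biweight_fiber, sum_mul_val_succ, Fin.sum_univ_succ] at hs
          rw [mem_biweight_fiber]
          simp only [Finsupp.tail_apply]
          omega
        · rw [← h0, Finsupp.cons_tail]
      · have h0' : Finsupp.single 0 1 ≤ s := by simpa [Nat.one_le_iff_ne_zero] using h0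
        refine Or.inl ⟨s - Finsupp.single 0 1, ?_, tsub_add_cancel_of_le h0'⟩
        rw [← tsub_add_cancel_of_le h0', map_add, Finsupp.weight_single] at hs
        rw [eq_sub_of_add_eq hs]
        simp [biweight]
  rw [monomialCount, ← h1, Set.ncard_union_eq ?_ ((biweight_fiber_finite _ _ _).image _)
    ((biweight_fiber_finite _ _ _).image _), Set.ncard_image_of_injective, monomialCount,
    Set.ncard_image_of_injective, monomialCount]
  · exact fun s t h => by simpa using congrArg Finsupp.tail h
  · exact add_left_injective _
  · rw [Set.disjoint_left]
    rintro _ ⟨s, -, rfl⟩ ⟨t, -, h⟩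
    simpa using DFunLike.congr_fun h 0

theorem qBinomCoeff_eq_monomialCount (l m k : ℕ) : qBinomCoeff l m k = monomialCount m l k := by
  induction m generalizing l k with
  | zero =>
    rw [monomialCount_zero_left, qBinomCoeff, qBinom_zero_right, coeff_one]
    simp
  | succ m ihm =>
    induction l generalizing k with
    | zero =>
      rw [Nat.cast_zero, monomialCount_zero_right, qBinomCoeff, qBinom_zero_left, coeff_one]
      simp
    | succ l ihl =>
      rw [monomialCount_succ, qBinomCoeff, qBinom_succ_succ', coeff_add, coeff_mul_X_pow',
        Nat.cast_add, add_comm]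
      congr 1
      · simpa [qBinomCoeff] using ihl k
      · split_ifs with h
        · have := ihm (l + 1) (k - (l + 1))
          rw [Nat.cast_sub h] at this
          exact_mod_cast this
        · rw [monomialCount_eq_zero (Or.inr (by push_cast; omega)), Nat.cast_zero]

theorem finrank_bigraded (l m k : ℕ) :
    (Module.finrank ℚ (bigraded m l k) : ℤ) = qBinomCoeff l m k := by
  rw [(bigraded_finite_finrank m l k).2, qBinomCoeff_eq_monomialCount, monomialCount]

theorem qBinomCoeff_lt_succ_iff {l m k : ℕ} (hk : 2 * k < l * m) :
    qBinomCoeff l m k < qBinomCoeff l m (k + 1) ↔ HasSeminvariant m l (k + 1 : ℕ) := by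
  have e : ((k + 1 : ℕ) : ℤ) - 1 = (k : ℕ) := by simp
  rw [← finrank_bigraded, ← finrank_bigraded, Nat.cast_lt]
  constructor
  · exact fun h => hasSeminvariant_of_finrank_lt (by rwa [e])
  · intro h
    have := h.finrank_lt (by rw [e]; exact_mod_cast hk)
    rwa [e] at this

theorem StrictlyIncreasing.hasSeminvariant {l m k : ℕ} (h : StrictlyIncreasing l m)
    (hk : 2 * k ≤ l * m) (h1 : k ≠ 1) : HasSeminvariant m l k := by
  rcases k with _ | k
  · exact hasSeminvariant_zero m l
  · exact (qBinomCoeff_lt_succ_iff (by omega)).mp (h k (by omega) hk)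

/-- Products of seminvariants give additivity of strict unimodality in one argument. -/
theorem StrictlyIncreasing.add {l l' m : ℕ} (h : StrictlyIncreasing l m)
    (h' : StrictlyIncreasing l' m) (he : Even (l * m)) (h6 : 6 ≤ l * m) (h6' : 6 ≤ l' * m) :
    StrictlyIncreasing (l + l') m := by
  intro k hk1 hk2
  rw [qBinomCoeff_lt_succ_iff (by omega)]
  obtain ⟨r, hr⟩ := he
  rw [add_mul] at hk2
  -- Weight `1` must be avoided, since `p_0 = p_1`. The greedy split `r + (k + 1 - r)` fails only at
  -- `k + 1 = r + 1`, where `(r - 1) + 2` works because both products are at least `6`. Evenness of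
  -- `l * m` makes the two half-ranges reach the middle of the sum.
  obtain ⟨a, b, hab, ha, hb, ha1, hb1⟩ : ∃ a b, k + 1 = a + b ∧ 2 * a ≤ l * m ∧
      2 * b ≤ l' * m ∧ a ≠ 1 ∧ b ≠ 1 := by
    by_cases c : k + 1 ≤ r
    · exact ⟨k + 1, 0, by omega⟩
    · by_cases c' : k + 1 = r + 1
      · exact ⟨r - 1, 2, by omega⟩
      · exact ⟨r, k + 1 - r, by omega⟩
  have := (h.hasSeminvariant ha ha1).mul (h'.hasSeminvariant hb hb1)
  rw [hab]
  exact_mod_cast this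

/-! ### Computing coefficients by evaluation at `q = 2 ^ 32`. -/

/-- The value of `qBinomNum ℓ m` at `2 ^ 32`. -/
def numValue (m : ℕ) : ℕ → ℕ
  | 0 => 1
  | l + 1 => numValue m l * ((2 ^ 32) ^ (m + (l + 1)) - 1)

/-- The value of `qBinom ℓ m` at `2 ^ 32`. -/
def gaussValue (l m : ℕ) : ℕ := numValue m l / numValue 0 l

/-- Comparison of the base `2 ^ 32` digits of `g` at positions `k` and `k + 1`. -/
def digitLt (g k : ℕ) : Bool :=
  (g / (2 ^ 32) ^ k % 2 ^ 32).blt (g / (2 ^ 32) ^ (k + 1) % 2 ^ 32)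

/-- The base `2 ^ 32` digits of `g` increase strictly from position `1` to position `n + 1`. -/
def digitsIncreasing (g : ℕ) : ℕ → Bool
  | 0 => true
  | n + 1 => digitLt g (n + 1) && digitsIncreasing g n

theorem eval_qBinomNum (l m : ℕ) : (qBinomNum l m).eval (2 ^ 32 : ℤ) = numValue m l := by
  induction l with
  | zero => simp [qBinomNum, numValue]
  | succ l ih =>
    rw [qBinomNum_succ, eval_mul, ih, numValue, Nat.cast_mul, 
      Nat.cast_sub (Nat.one_le_pow _ _ (by norm_num))]
    simp

theorem numValue_pos (m l : ℕ) : 0 < numValue m l := by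
  induction l with
  | zero => exact Nat.one_pos
  | succ l ih =>
    refine Nat.mul_pos ih (Nat.sub_pos_of_lt ?_)
    exact Nat.one_lt_pow (by omega) (by norm_num)

theorem sum_mul_pow_div_mod {N : ℕ} (k : ℕ) : ∀ (f : ℕ → ℕ), (∀ i, f i < N) → ∀ n, k < n →
    (∑ i ∈ Finset.range n, f i * N ^ i) / N ^ k % N = f k := by
  induction k with
  | zero =>
    intro f hf n hn
    obtain ⟨n, rfl⟩ := Nat.exists_eq_succ_of_ne_zero hn.ne'
    rw [Finset.sum_range_succ']
    simp only [pow_succ, ← mul_assoc, ← Finset.sum_mul]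
    simp [Nat.mod_eq_of_lt (hf 0)]
  | succ k ih =>
    intro f hf n hn
    obtain ⟨n, rfl⟩ := Nat.exists_eq_succ_of_ne_zero (show n ≠ 0 by omega)
    have hN : 0 < N := (Nat.zero_le _).trans_lt (hf 0)
    rw [Finset.sum_range_succ']
    simp only [pow_succ, ← mul_assoc, ← Finset.sum_mul]
    rw [mul_comm (N ^ k), ← Nat.div_div_eq_div_mul, pow_zero, mul_one, add_comm,
      Nat.add_mul_div_right _ _ hN, Nat.div_eq_of_lt (hf 0), zero_add]
    exact ih (fun i => f (i + 1)) (fun i => hf _) n (by omega)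

theorem qBinomCoeff_le_two_pow (l m k : ℕ) : qBinomCoeff l m k ≤ 2 ^ (l + m) := by
  have h1 : ∀ n k : ℕ, (1 : ℤ[X]).coeff k ≤ 2 ^ n := fun n k => by
    have : (1 : ℤ) ≤ 2 ^ n := one_le_pow₀ (by norm_num)
    rw [coeff_one]
    split_ifs <;> omega
  induction m generalizing l k with
  | zero => rw [qBinomCoeff, qBinom_zero_right]; exact h1 _ _
  | succ m ihm =>
    induction l generalizing k with
    | zero => rw [qBinomCoeff, qBinom_zero_left]; exact h1 _ _
    | succ l ihl =>
      have e1 := ihl k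
      have e2 := ihm (l + 1) (k - (l + 1))
      rw [qBinomCoeff] at e1 e2
      rw [qBinomCoeff, qBinom_succ_succ', coeff_add, coeff_mul_X_pow']
      rw [show l + 1 + (m + 1) = l + (m + 1) + 1 by ring, pow_succ]
      rw [show l + 1 + m = l + (m + 1) by ring] at e2
      have : (0 : ℤ) < 2 ^ (l + (m + 1)) := by positivity
      split_ifs <;> linarith

theorem gaussValue_digit {l m k : ℕ} (h : l + m < 32) (hk : k ≤ l * m) :
    qBinomCoeff l m k = (gaussValue l m / (2 ^ 32) ^ k % 2 ^ 32 : ℕ) := by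
  -- Coefficients are counts, hence nonnegative, and below the base: no carries occur and they are
  -- exactly the digits.
  have hc : ∀ i : ℕ, monomialCount m l i < 2 ^ 32 := fun i => by
    have h1 := qBinomCoeff_le_two_pow l m i
    rw [qBinomCoeff_eq_monomialCount] at h1
    have h2 : 2 ^ (l + m) < 2 ^ 32 := Nat.pow_lt_pow_right (by norm_num) h
    exact lt_of_le_of_lt (by exact_mod_cast h1) h2
  have hv : gaussValue l m = ∑ i ∈ Finset.range (l * m + 1), monomialCount m l i * (2 ^ 32) ^ i := by
    have h1 := congrArg (eval (2 ^ 32 : ℤ)) (qBinomDen_mul_qBinom l m)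
    rw [eval_mul, qBinomDen_eq, eval_qBinomNum, eval_qBinomNum, eval_eq_sum_range,
      natDegree_qBinom] at h1
    refine Nat.div_eq_of_eq_mul_right (numValue_pos 0 l) ?_
    zify
    rw [← h1]
    congr 1
    exact Finset.sum_congr rfl fun i _ => by rw [← qBinomCoeff_eq_monomialCount, qBinomCoeff]
  rw [hv, sum_mul_pow_div_mod k (fun i => monomialCount m l i) hc _ (by omega),
    qBinomCoeff_eq_monomialCount]

theorem qBinomCoeff_lt_iff_digitLt {l m k : ℕ} (h : l + m < 32) (hk : k + 1 ≤ l * m) :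
    qBinomCoeff l m k < qBinomCoeff l m (k + 1) ↔ digitLt (gaussValue l m) k = true := by
  rw [gaussValue_digit h (by omega), gaussValue_digit h hk, Nat.cast_lt, digitLt, Nat.blt_eq]

theorem digitLt_of_digitsIncreasing {g n : ℕ} (h : digitsIncreasing g n = true) :
    ∀ k, 1 ≤ k → k ≤ n → digitLt g k = true := by
  induction n with
  | zero => omega
  | succ n ih =>
    rw [digitsIncreasing, Bool.and_eq_true] at h
    intro k h1 h2
    rcases h2.eq_or_lt with rfl | h3
    · exact h.1
    · exact ih h.2 k h1 (by omega)

theorem strictlyIncreasing_of_digits {l m : ℕ}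
    (h : (decide (l + m < 32) && digitsIncreasing (gaussValue l m) (l * m / 2 - 1)) = true) :
    StrictlyIncreasing l m := by
  rw [Bool.and_eq_true, decide_eq_true_eq] at h
  intro k h1 h2
  rw [qBinomCoeff_lt_iff_digitLt h.1 (by omega)]
  exact digitLt_of_digitsIncreasing h.2 k h1 (by omega)

theorem not_strictlyIncreasing_of_digit {l m : ℕ} (k : ℕ)
    (h : (decide (l + m < 32 ∧ 1 ≤ k ∧ 2 * (k + 1) ≤ l * m) && !digitLt (gaussValue l m) k) = true) :
    ¬ StrictlyIncreasing l m := by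
  rw [Bool.and_eq_true, decide_eq_true_eq] at h
  obtain ⟨⟨h1, h2, h3⟩, h4⟩ := h
  intro hs
  have := (qBinomCoeff_lt_iff_digitLt h1 (by omega)).mp (hs k h2 h3)
  simp [this] at h4

/-! ### Positive cases: base pairs and steps of `8`. -/

theorem strictlyIncreasing_of_lt_sixteen {l m : ℕ} (hl : 8 ≤ l) (hl' : l < 16) (hm : 8 ≤ m)
    (hm' : m < 16) : StrictlyIncreasing l m := by
  have h : ∀ a < 8, ∀ b < 8, (decide (a + 8 + (b + 8) < 32) &&
      digitsIncreasing (gaussValue (a + 8) (b + 8)) ((a + 8) * (b + 8) / 2 - 1)) = true := by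
    decide +kernel
  have := strictlyIncreasing_of_digits (h (l - 8) (by omega) (m - 8) (by omega))
  rwa [Nat.sub_add_cancel hl, Nat.sub_add_cancel hm] at this

theorem StrictlyIncreasing.add_eight {l m : ℕ} (h : StrictlyIncreasing l m)
    (h8 : StrictlyIncreasing 8 m) (h6 : 6 ≤ l * m) : StrictlyIncreasing (l + 8) m := by
  rw [add_comm]
  refine h8.add h ⟨4 * m, by ring⟩ ?_ h6
  rcases Nat.eq_zero_or_pos m with rfl | hm <;> omega

theorem strictlyIncreasing_of_periodic {m : ℕ} (hm : 6 ≤ m) (h8 : StrictlyIncreasing 8 m)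
    (hb : ∀ l, 8 ≤ l → l < 16 → StrictlyIncreasing l m) {l : ℕ} (hl : 8 ≤ l) :
    StrictlyIncreasing l m := by
  induction l using Nat.strong_induction_on with
  | _ l ih =>
    by_cases h : l < 16
    · exact hb l hl h
    · have := (ih (l - 8) (by omega) (by omega)).add_eight h8 (by nlinarith [show 8 ≤ l - 8 by omega])
      rwa [Nat.sub_add_cancel hl] at this

theorem strictlyIncreasing_of_eight_le {l m : ℕ} (hl : 8 ≤ l) (hm : 8 ≤ m) :
    StrictlyIncreasing l m := by
  have h : ∀ {a b : ℕ}, 8 ≤ a → 8 ≤ b → b < 16 → StrictlyIncreasing a b := fun ha hb hb' =>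
    strictlyIncreasing_of_periodic (by omega)
      (strictlyIncreasing_of_lt_sixteen le_rfl (by norm_num) hb hb')
      (fun l hl hl' => strictlyIncreasing_of_lt_sixteen hl hl' hb hb') ha
  exact strictlyIncreasing_of_periodic (by omega) (h hm le_rfl (by norm_num)).comm
    (fun a ha ha' => (h hm ha ha').comm) hl

/-- Here `p` describes the admissible `l` in a row with exceptions. The condition `3 ≤ l - 8` with
`2 ≤ m` supplies the bound `6 ≤ (l - 8) * m` needed for additivity. -/
theorem strictlyIncreasing_of_steps {m : ℕ} (h8 : StrictlyIncreasing 8 m) (p : ℕ → Prop)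
    (hm : 2 ≤ m) (hp : ∀ l, p l → StrictlyIncreasing l m ∨ 3 ≤ l - 8 ∧ p (l - 8))
    {l : ℕ} (hl : p l) : StrictlyIncreasing l m := by
  induction l using Nat.strong_induction_on with
  | _ l ih =>
    rcases hp l hl with h | ⟨h, h'⟩
    · exact h
    · have := (ih (l - 8) (by omega) h').add_eight h8 (by nlinarith)
      rwa [Nat.sub_add_cancel (by omega)] at this

theorem strictlyIncreasing_five {l : ℕ} (hl : 5 ≤ l) (h6 : l ≠ 6) (h10 : l ≠ 10) (h14 : l ≠ 14) :
    StrictlyIncreasing l 5 := by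
  -- One base value per residue class modulo `8`, beyond the exceptions: `18` replaces `10`, and
  -- `22` replaces `6` and `14`.
  have hb : ∀ l ∈ [5, 7, 8, 9, 11, 12, 18, 22], StrictlyIncreasing l 5 := by
    have h : ∀ l ∈ [5, 7, 8, 9, 11, 12, 18, 22], (decide (l + 5 < 32) &&
        digitsIncreasing (gaussValue l 5) (l * 5 / 2 - 1)) = true := by decide +kernel
    exact fun l hl => strictlyIncreasing_of_digits (h l hl)
  refine strictlyIncreasing_of_steps (hb 8 (by simp)) (fun l => 5 ≤ l ∧ l ≠ 6 ∧ l ≠ 10 ∧ l ≠ 14)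
    (by norm_num) (fun l hl => ?_) ⟨hl, h6, h10, h14⟩
  by_cases h : l ∈ [5, 7, 8, 9, 11, 12, 18, 22]
  · exact Or.inl (hb l h)
  · simp at h
    omega

theorem strictlyIncreasing_six {l : ℕ} (hl : 8 ≤ l) (h9 : l ≠ 9) (h11 : l ≠ 11) (h13 : l ≠ 13) :
    StrictlyIncreasing l 6 := by
  -- Again one value per class modulo `8`; `17`, `19`, `21` replace the exceptions `9`, `11`, `13`.
  have hb : ∀ l ∈ [8, 10, 12, 14, 15, 17, 19, 21], StrictlyIncreasing l 6 := by
    have h : ∀ l ∈ [8, 10, 12, 14, 15, 17, 19, 21], (decide (l + 6 < 32) &&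
        digitsIncreasing (gaussValue l 6) (l * 6 / 2 - 1)) = true := by decide +kernel
    exact fun l hl => strictlyIncreasing_of_digits (h l hl)
  refine strictlyIncreasing_of_steps (hb 8 (by simp)) (fun l => 8 ≤ l ∧ l ≠ 9 ∧ l ≠ 11 ∧ l ≠ 13)
    (by norm_num) (fun l hl => ?_) ⟨hl, h9, h11, h13⟩
  by_cases h : l ∈ [8, 10, 12, 14, 15, 17, 19, 21]
  · exact Or.inl (hb l h)
  · simp at h
    omega

theorem strictlyIncreasing_seven {l : ℕ} (hl : 7 ≤ l) (h10 : l ≠ 10) : StrictlyIncreasing l 7 := by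
  have hb : ∀ l ∈ [7, 8, 9, 11, 12, 13, 14, 18], StrictlyIncreasing l 7 := by
    have h : ∀ l ∈ [7, 8, 9, 11, 12, 13, 14, 18], (decide (l + 7 < 32) &&
        digitsIncreasing (gaussValue l 7) (l * 7 / 2 - 1)) = true := by decide +kernel
    exact fun l hl => strictlyIncreasing_of_digits (h l hl)
  refine strictlyIncreasing_of_steps (hb 8 (by simp)) (fun l => 7 ≤ l ∧ l ≠ 10)
    (by norm_num) (fun l hl => ?_) ⟨hl, h10⟩
  by_cases h : l ∈ [7, 8, 9, 11, 12, 13, 14, 18]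
  · exact Or.inl (hb l h)
  · simp at h
    omega

/-! ### Failure for `ℓ = 2, 3, 4`. -/

/-- The number of partitions of `n` into parts `2` and `3`. -/
def partsTwoThree (n : ℕ) : ℤ := if n % 6 = 1 then n / 6 else n / 6 + 1

/-- The number of partitions of `n` into parts `2`, `3` and `4`. -/
def partsTwoThreeFour (n : ℕ) : ℤ :=
  if 4 ≤ n then partsTwoThreeFour (n - 4) + partsTwoThree n else partsTwoThree n

theorem partsTwoThreeFour_add_four (n : ℕ) :
    partsTwoThreeFour (n + 4) = partsTwoThreeFour n + partsTwoThree (n + 4) := by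
  rw [partsTwoThreeFour, if_pos (by omega), Nat.add_sub_cancel]

theorem partsTwoThreeFour_of_lt {n : ℕ} (h : n < 4) : partsTwoThreeFour n = partsTwoThree n := by
  rw [partsTwoThreeFour, if_neg (by omega)]

theorem partsTwoThree_series :
    ((1 - PowerSeries.X ^ 2) * (1 - PowerSeries.X ^ 3)) * PowerSeries.mk partsTwoThree = 1 := by
  rw [show ((1 - PowerSeries.X ^ 2) * (1 - PowerSeries.X ^ 3)) * PowerSeries.mk partsTwoThree =
    PowerSeries.mk partsTwoThree - PowerSeries.X ^ 2 * PowerSeries.mk partsTwoThree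
    - PowerSeries.X ^ 3 * PowerSeries.mk partsTwoThree
    + PowerSeries.X ^ 5 * PowerSeries.mk partsTwoThree by ring]
  ext n
  simp only [map_add, map_sub, PowerSeries.coeff_X_pow_mul', PowerSeries.coeff_mk,
    PowerSeries.coeff_one, partsTwoThree]
  split_ifs <;> omega

theorem partsTwoThreeFour_series :
    (1 - PowerSeries.X ^ 4) * PowerSeries.mk partsTwoThreeFour = PowerSeries.mk partsTwoThree := by
  rw [sub_mul, one_mul]
  ext n
  simp only [map_sub, PowerSeries.coeff_X_pow_mul', PowerSeries.coeff_mk]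
  rw [partsTwoThreeFour]
  split_ifs <;> ring

theorem coeff_one_sub_X_mul_qBinom (l m k : ℕ) :
    PowerSeries.coeff (k + 1) ((1 - PowerSeries.X) * (qBinom l m : PowerSeries ℤ)) =
      qBinomCoeff l m (k + 1) - qBinomCoeff l m k := by
  rw [sub_mul, one_mul, map_sub, PowerSeries.coeff_succ_X_mul, coeff_coe, coeff_coe]
  rfl

/-- Below degree `m + 1`, `(1 - q)` times the Gaussian coefficient agrees with `1 / (1 - q^2)`,
whose odd coefficients vanish; hence `p_3 = p_2`. -/
theorem not_strictlyIncreasing_two {m : ℕ} (hm : 3 ≤ m) : ¬ StrictlyIncreasing 2 m := by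
  have h := congrArg (fun p : ℤ[X] => (p : PowerSeries ℤ)) (qBinomDen_mul_qBinom 2 m)
  simp only [qBinomDen, qBinomNum, Finset.prod_Icc_succ_top (show 1 ≤ 1 + 1 by norm_num),
    Finset.Icc_self, Finset.prod_singleton, Polynomial.coe_mul, Polynomial.coe_sub,
    Polynomial.coe_pow, Polynomial.coe_X, Polynomial.coe_one] at h
  have h1 : (1 - PowerSeries.X ^ 2) * ((1 - PowerSeries.X) * (qBinom 2 m : PowerSeries ℤ)) =
      1 - PowerSeries.X ^ (m + 1) * (1 + PowerSeries.X - PowerSeries.X ^ (m + 2)) := by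
    linear_combination h
  rw [sub_mul, one_mul] at h1
  have h2 := congrArg (PowerSeries.coeff 1) h1
  have h3 := congrArg (PowerSeries.coeff 3) h1
  rw [map_sub, map_sub, PowerSeries.coeff_X_pow_mul', PowerSeries.coeff_X_pow_mul',
    coeff_one_sub_X_mul_qBinom, PowerSeries.coeff_one, if_neg (by omega), if_neg (by omega),
    if_neg (by omega)] at h2
  rw [map_sub, map_sub, PowerSeries.coeff_X_pow_mul', PowerSeries.coeff_X_pow_mul',
    coeff_one_sub_X_mul_qBinom, PowerSeries.coeff_one, if_pos (by omega), if_neg (by omega),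
    if_neg (by omega), show 3 - 2 = 0 + 1 from rfl, coeff_one_sub_X_mul_qBinom] at h3
  intro hs
  have := hs 2 (by norm_num) (by omega)
  simp only [zero_add, Nat.reduceAdd] at h2 h3 this
  omega

/-- Expand `(1 - q^(m+1))(1 - q^(m+2))(1 - q^(m+3))` over `(1 - q^2)(1 - q^3)`. Products of two or
more of the powers `q^(m+i)` have degree above `2m + 2`, so only the single shifts contribute. -/
theorem qBinomCoeff_three_succ_sub {m k : ℕ} (hk : k ≤ 2 * m) :
    qBinomCoeff 3 m (k + 1) - qBinomCoeff 3 m k = partsTwoThree (k + 1)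
      - (if m + 1 ≤ k + 1 then partsTwoThree (k + 1 - (m + 1)) else 0)
      - (if m + 2 ≤ k + 1 then partsTwoThree (k + 1 - (m + 2)) else 0)
      - (if m + 3 ≤ k + 1 then partsTwoThree (k + 1 - (m + 3)) else 0) := by
  have h := congrArg (fun p : ℤ[X] => (p : PowerSeries ℤ)) (qBinomDen_mul_qBinom 3 m)
  simp only [qBinomDen, qBinomNum, Finset.prod_Icc_succ_top (show 1 ≤ 1 + 1 by norm_num),
    Finset.prod_Icc_succ_top (show 1 ≤ 2 + 1 by norm_num),
    Finset.Icc_self, Finset.prod_singleton, Polynomial.coe_mul, Polynomial.coe_sub,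
    Polynomial.coe_pow, Polynomial.coe_X, Polynomial.coe_one] at h
  set S := PowerSeries.mk partsTwoThree with hS
  have h1 : (1 - PowerSeries.X) * (qBinom 3 m : PowerSeries ℤ) =
      S - PowerSeries.X ^ (m + 1) * S - PowerSeries.X ^ (m + 2) * S - PowerSeries.X ^ (m + 3) * S
      + PowerSeries.X ^ (2 * m + 2) * ((PowerSeries.X + PowerSeries.X ^ 2 + PowerSeries.X ^ 3
        - PowerSeries.X ^ m * PowerSeries.X ^ 4) * S) := by
    linear_combination (-S) * h - ((1 - PowerSeries.X) * (qBinom 3 m : PowerSeries ℤ)) *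
      partsTwoThree_series
  rw [← coeff_one_sub_X_mul_qBinom, h1]
  simp only [map_add, map_sub, PowerSeries.coeff_X_pow_mul', hS, PowerSeries.coeff_mk]
  rw [if_neg (show ¬ 2 * m + 2 ≤ k + 1 by omega), add_zero]

theorem qBinomCoeff_four_succ_sub {m k : ℕ} (hk : k ≤ 2 * m) :
    qBinomCoeff 4 m (k + 1) - qBinomCoeff 4 m k = partsTwoThreeFour (k + 1)
      - (if m + 1 ≤ k + 1 then partsTwoThreeFour (k + 1 - (m + 1)) else 0)
      - (if m + 2 ≤ k + 1 then partsTwoThreeFour (k + 1 - (m + 2)) else 0)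
      - (if m + 3 ≤ k + 1 then partsTwoThreeFour (k + 1 - (m + 3)) else 0)
      - (if m + 4 ≤ k + 1 then partsTwoThreeFour (k + 1 - (m + 4)) else 0) := by
  have h := congrArg (fun p : ℤ[X] => (p : PowerSeries ℤ)) (qBinomDen_mul_qBinom 4 m)
  simp only [qBinomDen, qBinomNum, Finset.prod_Icc_succ_top (show 1 ≤ 1 + 1 by norm_num),
    Finset.prod_Icc_succ_top (show 1 ≤ 2 + 1 by norm_num),
    Finset.prod_Icc_succ_top (show 1 ≤ 3 + 1 by norm_num),
    Finset.Icc_self, Finset.prod_singleton, Polynomial.coe_mul, Polynomial.coe_sub,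
    Polynomial.coe_pow, Polynomial.coe_X, Polynomial.coe_one] at h
  set S := PowerSeries.mk partsTwoThreeFour with hS
  have h0 : (1 - PowerSeries.X ^ 2) * (1 - PowerSeries.X ^ 3) * ((1 - PowerSeries.X ^ 4) * S) =
      1 := by
    rw [partsTwoThreeFour_series, partsTwoThree_series]
  have h1 : (1 - PowerSeries.X) * (qBinom 4 m : PowerSeries ℤ) =
      S - PowerSeries.X ^ (m + 1) * S - PowerSeries.X ^ (m + 2) * S - PowerSeries.X ^ (m + 3) * S
      - PowerSeries.X ^ (m + 4) * S
      + PowerSeries.X ^ (2 * m + 2) * ((PowerSeries.X + PowerSeries.X ^ 2 + 2 * PowerSeries.X ^ 3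
        + PowerSeries.X ^ 4 + PowerSeries.X ^ 5
        - PowerSeries.X ^ m * (PowerSeries.X ^ 4 + PowerSeries.X ^ 5 + PowerSeries.X ^ 6
          + PowerSeries.X ^ 7) + (PowerSeries.X ^ m) ^ 2 * PowerSeries.X ^ 8) * S) := by
    linear_combination S * h - ((1 - PowerSeries.X) * (qBinom 4 m : PowerSeries ℤ)) * h0
  rw [← coeff_one_sub_X_mul_qBinom, h1]
  simp only [map_add, map_sub, PowerSeries.coeff_X_pow_mul', hS, PowerSeries.coeff_mk]
  rw [if_neg (show ¬ 2 * m + 2 ≤ k + 1 by omega), add_zero]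

theorem not_strictlyIncreasing_three {m : ℕ} (hm : 3 ≤ m) : ¬ StrictlyIncreasing 3 m := by
  -- The step that fails is the last one before the middle, except for `4 ∣ m`, where it is the one
  -- before that.
  obtain ⟨k, hk, hk1, hk2, he⟩ : ∃ k, k ≤ 2 * m ∧ 1 ≤ k ∧ 2 * (k + 1) ≤ 3 * m ∧
      (m % 4 = 0 ∧ 2 * k + 4 = 3 * m ∨ m % 4 = 2 ∧ 2 * k + 2 = 3 * m ∨ 2 * k + 3 = 3 * m) := by
    rcases Nat.even_or_odd' m with ⟨j, rfl | rfl⟩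
    · rcases Nat.even_or_odd' j with ⟨i, rfl | rfl⟩
      · exact ⟨6 * i - 2, by omega⟩
      · exact ⟨6 * i + 2, by omega⟩
    · exact ⟨3 * j, by omega⟩
  intro hs
  have h1 := hs k hk1 hk2
  have h2 := qBinomCoeff_three_succ_sub hk
  simp only [partsTwoThree] at h2
  split_ifs at h2 <;> omega

/-- This says that the difference `p_(2m-1) - p_(2m-2)` for `ℓ = 4`, `m = j + 5` is zero. Passing
from `j` to `j + 2` reduces it to `partsTwoThree (2j + 13) = partsTwoThree (j + 5) + partsTwoThree
(j + 4)`. -/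
theorem partsTwoThreeFour_odd (j : ℕ) : partsTwoThreeFour (2 * j + 9) =
    partsTwoThreeFour (j + 3) + partsTwoThreeFour (j + 2) + partsTwoThreeFour (j + 1)
      + partsTwoThreeFour j := by
  induction j using Nat.twoStepInduction with
  | zero =>
    have h1 := partsTwoThreeFour_add_four 5
    have h2 := partsTwoThreeFour_add_four 1
    norm_num at h1 h2 ⊢
    rw [h1, h2]
    simp only [partsTwoThreeFour_of_lt (show 0 < 4 by norm_num),
      partsTwoThreeFour_of_lt (show 1 < 4 by norm_num),
      partsTwoThreeFour_of_lt (show 2 < 4 by norm_num),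
      partsTwoThreeFour_of_lt (show 3 < 4 by norm_num)]
    decide
  | one =>
    have h1 := partsTwoThreeFour_add_four 7
    have h2 := partsTwoThreeFour_add_four 3
    have h3 := partsTwoThreeFour_add_four 0
    norm_num at h1 h2 h3 ⊢
    rw [h1, h2, h3]
    simp only [partsTwoThreeFour_of_lt (show 0 < 4 by norm_num),
      partsTwoThreeFour_of_lt (show 1 < 4 by norm_num),
      partsTwoThreeFour_of_lt (show 2 < 4 by norm_num),
      partsTwoThreeFour_of_lt (show 3 < 4 by norm_num)]
    decide
  | more j ih _ =>
    rw [show 2 * (j + 2) + 9 = 2 * j + 9 + 4 by ring, show j + 2 + 3 = j + 1 + 4 by ring,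
      show j + 2 + 2 = j + 4 by ring, show j + 2 + 1 = j + 3 by ring]
    rw [partsTwoThreeFour_add_four (2 * j + 9), ih, partsTwoThreeFour_add_four (j + 1),
      partsTwoThreeFour_add_four j]
    have : partsTwoThree (2 * j + 9 + 4) = partsTwoThree (j + 1 + 4) + partsTwoThree (j + 4) := by
      simp only [partsTwoThree]
      split_ifs <;> omega
    rw [this]
    ring

theorem not_strictlyIncreasing_four {m : ℕ} (hm : 4 ≤ m) : ¬ StrictlyIncreasing 4 m := by
  rcases hm.eq_or_lt with rfl | hm
  · exact not_strictlyIncreasing_of_digit 6 (by decide +kernel)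
  obtain ⟨j, rfl⟩ := Nat.exists_eq_add_of_le' hm
  intro hs
  have h1 := hs (2 * j + 8) (by omega) (by omega)
  have h2 := qBinomCoeff_four_succ_sub (m := j + Nat.succ 4) (k := 2 * j + 8) (by omega)
  rw [if_pos (by omega), if_pos (by omega), if_pos (by omega), if_pos (by omega),
    show 2 * j + 8 + 1 - (j + Nat.succ 4 + 1) = j + 3 by omega,
    show 2 * j + 8 + 1 - (j + Nat.succ 4 + 2) = j + 2 by omega,
    show 2 * j + 8 + 1 - (j + Nat.succ 4 + 3) = j + 1 by omega,
    show 2 * j + 8 + 1 - (j + Nat.succ 4 + 4) = j by omega, partsTwoThreeFour_odd] at h2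
  linarith

/-! ### Assembly of the classification. -/

theorem strictlyIncreasing_iff {l m : ℕ} (hl : 2 ≤ l) (hlm : l ≤ m) :
    StrictlyIncreasing l m ↔
      (l = 2 ∧ m = 2) ∨
      (5 ≤ l ∧ 5 ≤ m ∧
        (l, m) ∉ ({(5, 6), (5, 10), (5, 14), (6, 6), (6, 7), (6, 9), (6, 11), (6, 13),
          (7, 10)} : Set (ℕ × ℕ))) := by
  simp only [Set.mem_insert_iff, Set.mem_singleton_iff, Prod.mk.injEq]
  constructor
  · intro h
    by_cases h2 : l = 2
    · subst h2
      by_contra hc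
      exact not_strictlyIncreasing_two (by omega) h
    by_cases h3 : l = 3
    · subst h3
      exact absurd h (not_strictlyIncreasing_three hlm)
    by_cases h4 : l = 4
    · subst h4
      exact absurd h (not_strictlyIncreasing_four hlm)
    refine Or.inr ⟨by omega, by omega, ?_⟩
    rintro (⟨rfl, rfl⟩ | ⟨rfl, rfl⟩ | ⟨rfl, rfl⟩ | ⟨rfl, rfl⟩ | ⟨rfl, rfl⟩ | ⟨rfl, rfl⟩ |
      ⟨rfl, rfl⟩ | ⟨rfl, rfl⟩ | ⟨rfl, rfl⟩)
    -- The witness is the last step `ℓm/2 - 1` before the middle (rounded down), except for `(6,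
    -- 6)`, where it is one step earlier.
    · exact not_strictlyIncreasing_of_digit 14 (by decide +kernel) h
    · exact not_strictlyIncreasing_of_digit 24 (by decide +kernel) h
    · exact not_strictlyIncreasing_of_digit 34 (by decide +kernel) h
    · exact not_strictlyIncreasing_of_digit 16 (by decide +kernel) h
    · exact not_strictlyIncreasing_of_digit 20 (by decide +kernel) h
    · exact not_strictlyIncreasing_of_digit 26 (by decide +kernel) h
    · exact not_strictlyIncreasing_of_digit 32 (by decide +kernel) h
    · exact not_strictlyIncreasing_of_digit 38 (by decide +kernel) h
    · exact not_strictlyIncreasing_of_digit 34 (by decide +kernel) h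
  · rintro (⟨rfl, rfl⟩ | ⟨h5, -, h⟩)
    · exact strictlyIncreasing_of_digits (by decide +kernel)
    by_cases h8 : 8 ≤ l
    · exact strictlyIncreasing_of_eight_le h8 (by omega)
    obtain rfl | rfl | rfl : l = 5 ∨ l = 6 ∨ l = 7 := by omega
    · exact (strictlyIncreasing_five hlm (by omega) (by omega) (by omega)).comm
    · exact (strictlyIncreasing_six (by omega) (by omega) (by omega) (by omega)).comm
    · exact (strictlyIncreasing_seven hlm (by omega)).comm

theorem theoremt (ℓ m : ℕ) (hℓ : 2 ≤ ℓ) (hm : 2 ≤ m) (hℓm : ℓ ≤ m) :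
    StrictlyUnimodal ℓ m ↔
      (ℓ = 2 ∧ m = 2) ∨
      (5 ≤ ℓ ∧ 5 ≤ m ∧
        (ℓ, m) ∉ ({(5, 6), (5, 10), (5, 14), (6, 6), (6, 7), (6, 9), (6, 11), (6, 13),
          (7, 10)} : Set (ℕ × ℕ))) := by
  rw [strictlyUnimodal_iff, strictlyIncreasing_iff hℓ hℓm]
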